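/- Let $n$ be a natural number, $J \in \mathbb{R}$ with $J \le 0$, and $h_1, \dots, h_n \in \mathbb{R}$. Let $\mu$ be the Ising Curie–Weiss measure with interaction parameter $J$ and external fields $h_1, \dots, h_n$, i.e. the probability distribution on $\Omega = \{-1,+1\}^n$ given by $$\mu(\omega) = \frac{1}{Z} \exp\Big( \sum_{1 \le i < j \le n} J\, \omega_i \omega_j + \sum_{i=1}^n h_i\, \omega_i \Big), \qquad \omega \in \Omega,$$ where $Z$ is the normalizing constant. For $\omega \in \Omega$ and $K \subseteq \{1,\dots,n\}$ let $[\omega]_K = \{\alpha \in \Omega : \alpha_i = \omega_i \text{ for all } i \in K\}$, and for $A, B \subseteq \Omega$ let $$A \,\square\, B = \{\omega \in \Omega : \text{there are disjoint } K, L \subseteq \{1,\dots,n\} \text{ with } [\omega]_K \subseteq A \text{ and } [\omega]_L \subseteq B\}.$$ Call $A \subseteq \Omega$ increasing if $\omega' \in A$ whenever $\omega \in A$ and $\omega'_i \ge \omega_i$ for all $i$. Then for all increasing $A, B \subseteq \Omega$, $$\mu(A \,\square\, B) \le \mu(A)\,\mu(B).$$ -/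

import Mathlib

namespace CurieWeiss

/-- The set of configurations that agree with `ω` on the index set `K`. -/
def cylinder {S : Type*} {n : ℕ} (ω : Fin n → S) (K : Finset (Fin n)) : Set (Fin n → S) :=
  {α | ∀ i ∈ K, α i = ω i}

/-- The disjoint occurrence `A □ B` of two events: some disjoint index sets `K` and `L` are
witnesses for `A` and for `B` respectively. -/
def box {S : Type*} {n : ℕ} (A B : Set (Fin n → S)) : Set (Fin n → S) :=
  {ω | ∃ K L : Finset (Fin n), Disjoint K L ∧ cylinder ω K ⊆ A ∧ cylinder ω L ⊆ B}

/-- The spin space `{-1, +1}`, with the order `-1 < +1` inherited from `ℤ`. -/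
abbrev Spin : Type := ({-1, 1} : Finset ℤ)

/-- The value of a spin as a real number. -/
def spinVal (s : Spin) : ℝ := ((s : ℤ) : ℝ)

/-- The unnormalized weight
`exp (∑_{i < j} J ω_i ω_j + ∑_i h_i ω_i)`; each unordered pair of vertices is counted once. -/
noncomputable def weight {n : ℕ} (J : ℝ) (h : Fin n → ℝ) (ω : Fin n → Spin) : ℝ :=
  Real.exp ((∑ i, ∑ j ∈ Finset.Ioi i, J * spinVal (ω i) * spinVal (ω j))
    + ∑ i, h i * spinVal (ω i))

/-- The normalizing constant `Z`. -/
noncomputable def partitionFunction {n : ℕ} (J : ℝ) (h : Fin n → ℝ) : ℝ :=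
  ∑ ω : Fin n → Spin, weight J h ω

/-- The probability of a configuration under the Ising Curie-Weiss measure. -/
noncomputable def mass {n : ℕ} (J : ℝ) (h : Fin n → ℝ) (ω : Fin n → Spin) : ℝ :=
  weight J h ω / partitionFunction J h

/-- The probability of an event under the Ising Curie-Weiss measure. -/
noncomputable def prob {n : ℕ} (J : ℝ) (h : Fin n → ℝ) (A : Set (Fin n → Spin)) : ℝ :=
  ∑ ω : Fin n → Spin, A.indicator (mass J h) ω

end CurieWeiss

open Finset

namespace CurieWeiss

/-! Expand `μ(A) μ(B) - μ(A □ B)` over pairs of configurations, grouped by the set `D` where they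
disagree and their common spins off `D`. On `D` the two are flips of each other, so in the product
weight only `exp (-J (|D|² - M²))` depends on the spins `β` on `D`, where `M` is their sum. It
remains to show that this weight gives `{β ∈ A, flip β ∈ B}` at least the mass of the disjoint
occurrence (`sum_exp_mul_defect_nonneg`).

Since `-J ≥ 0`, expand the exponential. `|D|² - M²` is twice the number of ordered pairs of opposite
spins, so its powers are nonnegative combinations of indicators that the edges of a partial matching
carry opposite spins (`Pairing`). On such an event single sites and opposite pairs flip
independently. Increasing events have witnesses made of plus spins, and a pair has only one plus
spin, so disjoint witnesses meet disjoint sets of pairs. This reduces everything to Reimer's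
inequality on the uniform cube, `card_cubeBox_le`, which is proved by linear algebra. -/

/-- Disjoint occurrence of two events on a Boolean cube over an arbitrary index type. -/
def cubeBox {ι : Type*} (A B : Set (ι → Bool)) : Set (ι → Bool) :=
  {ω | ∃ K L : Finset ι, Disjoint K L ∧ (∀ α : ι → Bool, (∀ i ∈ K, α i = ω i) → α ∈ A) ∧
    ∀ α : ι → Bool, (∀ i ∈ L, α i = ω i) → α ∈ B}

/-- The configuration with all coordinates flipped. -/
def flip {ι : Type*} (ω : ι → Bool) : ι → Bool := fun i => !ω i

/-- The entries of the orthogonal basis `(1, N), (-N, 1)` of the plane. -/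
def tiltedEntry (N : ℤ) (x z : Bool) : ℤ := if x = z then 1 else if z then N else -N

/-- The tensor product over `i` of standard basis vectors (for `i ∈ K`) and tilted basis vectors
(for `i ∉ K`) labelled by `x`. -/
def wingVector {ι : Type*} [Fintype ι] [DecidableEq ι] (N : ℤ) (K : Finset ι) (x z : ι → Bool) :
    ℤ :=
  ∏ i, if i ∈ K then (if x i = z i then 1 else 0) else tiltedEntry N (x i) (z i)

/-- The entries of the matrix with rows `(1, -s), (s, 1)`. -/
def rotEntry (s : ℝ) (z y : Bool) : ℝ := if z = y then 1 else if z then s else -s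

/-- The tensor power of the matrix with rows `(1, -s), (s, 1)`. -/
def rotTensor {ι : Type*} [Fintype ι] (s : ℝ) (z y : ι → Bool) : ℝ :=
  ∏ i, rotEntry s (z i) (y i)

/-! ### Reimer's inequality by a dimension count -/

section Reimer

variable {ι : Type*} [Fintype ι]

lemma prod_ite_eq_ite_funext {R : Type*} [CommSemiring R] (x z : ι → Bool) :
    (∏ i, if x i = z i then (1 : R) else 0) = if x = z then 1 else 0 := by
  split_ifs with h
  · simp [h]
  · obtain ⟨i, hi⟩ := Function.ne_iff.mp h
    exact Finset.prod_eq_zero (mem_univ i) (by simp [hi])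

lemma rotTensor_self (s : ℝ) (z : ι → Bool) : rotTensor s z z = 1 := by
  simp [rotTensor, rotEntry]

variable [DecidableEq ι]

lemma wingVector_zmod (N : ℕ) (K : Finset ι) (x z : ι → Bool) :
    ((wingVector (N : ℤ) K x z : ℤ) : ZMod N) = if x = z then 1 else 0 := by
  rw [← prod_ite_eq_ite_funext, wingVector, Int.cast_prod]
  refine Finset.prod_congr rfl fun i _ => ?_
  unfold tiltedEntry
  split_ifs <;> simp

lemma wingVector_eq_zero (N : ℤ) {K : Finset ι} {x z : ι → Bool} {i : ι} (hi : i ∈ K)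
    (h : z i ≠ x i) : wingVector N K x z = 0 :=
  Finset.prod_eq_zero (mem_univ i) (by simp [hi, h.symm])

/-- Modulo `N` the tilted basis becomes the standard one, so the matrix reduces to the identity for
every choice of `K`. -/
lemma det_wingVector_ne_zero {N : ℕ} (hN : 2 ≤ N) (K : (ι → Bool) → Finset ι) :
    (Matrix.of fun x z => wingVector (N : ℤ) (K x) x z).det ≠ 0 := by
  intro h
  have : Fact (1 < N) := ⟨hN⟩
  have h1 : (Int.castRingHom (ZMod N)).mapMatrix
      (Matrix.of fun x z => wingVector (N : ℤ) (K x) x z) = 1 := by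
    ext x z
    simp [wingVector_zmod, Matrix.one_apply]
  have h2 := congrArg (Int.castRingHom (ZMod N)) h
  rw [RingHom.map_det, h1, Matrix.det_one, map_zero] at h2
  exact one_ne_zero h2

lemma sum_wingVector_ne_zero {N : ℕ} (hN : 2 ≤ N) (K : (ι → Bool) → Finset ι)
    {l : (ι → Bool) → ℝ} (hl : l ≠ 0) :
    (fun z => ∑ x, l x * (wingVector (N : ℤ) (K x) x z : ℝ)) ≠ 0 := by
  intro h
  refine hl (Matrix.eq_zero_of_vecMul_eq_zero
    (M := (Int.castRingHom ℝ).mapMatrix (Matrix.of fun x z => wingVector (N : ℤ) (K x) x z))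
    ?_ ?_)
  · rw [← RingHom.map_det]
    simpa using det_wingVector_ne_zero hN K
  · ext z
    simpa [Matrix.vecMul, dotProduct] using congrFun h z

/-- For `s = 1 / N` each factor sends a tilted vector to a multiple of the opposite standard basis
vector, so one agreement off `K` kills the product. -/
lemma sum_rotTensor_mul_wingVector {N : ℕ} (hN : N ≠ 0) {K : Finset ι} {x z : ι → Bool} {i : ι}
    (hi : i ∉ K) (h : z i = x i) :
    ∑ y, rotTensor (1 / N : ℝ) z y * (wingVector (N : ℤ) K x y : ℝ) = 0 := by
  have hN' : (N : ℝ) ≠ 0 := by exact_mod_cast hN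
  have key : ∑ y : ι → Bool, rotTensor (1 / N : ℝ) z y * (wingVector (N : ℤ) K x y : ℝ)
      = ∏ j, ∑ b : Bool, rotEntry (1 / N : ℝ) (z j) b *
        ((if j ∈ K then (if x j = b then 1 else 0) else tiltedEntry N (x j) b : ℤ) : ℝ) := by
    rw [Finset.prod_univ_sum, Fintype.piFinset_univ]
    refine Finset.sum_congr rfl fun y _ => ?_
    rw [rotTensor, wingVector, Int.cast_prod, ← Finset.prod_mul_distrib]
  rw [key]
  refine Finset.prod_eq_zero (mem_univ i) ?_
  rw [h]
  cases x i <;> simp [hi, rotEntry, tiltedEntry, hN']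

lemma abs_rotTensor_le {s : ℝ} (h0 : 0 ≤ s) (h1 : s ≤ 1) {z y : ι → Bool} (h : z ≠ y) :
    |rotTensor s z y| ≤ s := by
  obtain ⟨i, hi⟩ := Function.ne_iff.mp h
  rw [rotTensor, Finset.abs_prod, ← Finset.mul_prod_erase _ _ (mem_univ i)]
  have ha : |rotEntry s (z i) (y i)| = s := by
    unfold rotEntry
    split_ifs <;> simp_all
  rw [ha]
  refine mul_le_of_le_one_right h0 (Finset.prod_le_one (fun _ _ => abs_nonneg _) fun j _ => ?_)
  unfold rotEntry
  split_ifs <;> simp [abs_of_nonneg h0, h1]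

/-- The diagonal is 1 and the other entries are at most `s` in absolute value, so by AM-GM the form
is at least `(1 - s * 2 ^ |ι|) ‖w‖²`. -/
lemma rotTensor_form_pos {s : ℝ} (h0 : 0 ≤ s) (h1 : s * Fintype.card (ι → Bool) < 1)
    {w : (ι → Bool) → ℝ} (hw : w ≠ 0) :
    0 < ∑ z, w z * ∑ y, rotTensor s z y * w y := by
  have hcard : (1 : ℝ) ≤ Fintype.card (ι → Bool) := by
    exact_mod_cast Fintype.card_pos
  have hs1 : s ≤ 1 := by nlinarith
  have hpos : 0 < ∑ z, w z ^ 2 := by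
    obtain ⟨z, hz⟩ := Function.ne_iff.mp hw
    exact Finset.sum_pos' (fun _ _ => sq_nonneg _) ⟨z, mem_univ z, by
      have : w z ≠ 0 := hz
      positivity⟩
  have hterm : ∀ z y : ι → Bool, (if z = y then w z ^ 2 else 0) - s * ((w z ^ 2 + w y ^ 2) / 2)
      ≤ w z * (rotTensor s z y * w y) := by
    intro z y
    split_ifs with h
    · subst h
      rw [rotTensor_self]
      nlinarith [mul_nonneg h0 (sq_nonneg (w z))]
    · have h2 := abs_le.mp (abs_rotTensor_le h0 hs1 h)
      have h3 : |w z * (rotTensor s z y * w y)| ≤ s * ((w z ^ 2 + w y ^ 2) / 2) := by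
        have : w z * (rotTensor s z y * w y) = rotTensor s z y * (w z * w y) := by ring
        rw [this, abs_mul]
        refine mul_le_mul (abs_rotTensor_le h0 hs1 h) ?_ (abs_nonneg _) h0
        rw [abs_le]
        constructor <;> nlinarith [sq_nonneg (w z + w y), sq_nonneg (w z - w y)]
      linarith [(abs_le.mp h3).1]
  have hsum := Finset.sum_le_sum fun z (_ : z ∈ univ) =>
    Finset.sum_le_sum fun y (_ : y ∈ univ) => hterm z y
  simp only [← Finset.mul_sum] at hsum
  refine lt_of_lt_of_le ?_ hsum
  have : ∑ z : ι → Bool, ∑ y : ι → Bool,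
      ((if z = y then w z ^ 2 else 0) - s * ((w z ^ 2 + w y ^ 2) / 2))
      = (1 - s * Fintype.card (ι → Bool)) * ∑ z, w z ^ 2 := by
    simp only [Finset.sum_sub_distrib, ← Finset.mul_sum, ← Finset.sum_div, Finset.sum_add_distrib]
    simp only [Finset.sum_ite_eq, mem_univ, if_true, Finset.sum_const, card_univ, nsmul_eq_mul,
      ← Finset.mul_sum]
    ring
  rw [this]
  exact mul_pos (by linarith) hpos

open Classical in
/-- Reimer's inequality for the uniform measure on the cube, in its folded form. -/
theorem card_cubeBox_le (A B : Set (ι → Bool)) :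
    Fintype.card (cubeBox A B) ≤ Fintype.card {ω | ω ∈ A ∧ flip ω ∈ B} := by
  by_contra! hlt
  -- Enlarging `L` to the complement of `K` lets one set serve both events.
  have hwit : ∀ x : ι → Bool, ∃ K : Finset ι, x ∈ cubeBox A B →
      (∀ α : ι → Bool, (∀ i ∈ K, α i = x i) → α ∈ A) ∧
      ∀ α : ι → Bool, (∀ i ∉ K, α i = x i) → α ∈ B := by
    intro x
    by_cases hx : x ∈ cubeBox A B
    · obtain ⟨K, L, hKL, hK, hL⟩ := hx
      exact ⟨K, fun _ => ⟨hK, fun α hα => hL α fun i hi =>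
        hα i (Finset.disjoint_right.mp hKL hi)⟩⟩
    · exact ⟨∅, fun h => absurd h hx⟩
  choose K hK using hwit
  set N : ℕ := Fintype.card (ι → Bool) + 1 with hNdef
  have hN : 2 ≤ N := by
    have : 0 < Fintype.card (ι → Bool) := Fintype.card_pos
    omega
  set s : ℝ := 1 / N with hs
  have hs0 : 0 ≤ s := by positivity
  have hs1 : s * Fintype.card (ι → Bool) < 1 := by
    rw [hs, one_div_mul_eq_div, div_lt_one (by positivity), hNdef]
    push_cast
    linarith
  let a : (ι → Bool) → (ι → Bool) → ℝ := fun x z => wingVector (N : ℤ) (K x) x z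
  let Φ : (cubeBox A B → ℝ) →ₗ[ℝ] ({ω | ω ∈ A ∧ flip ω ∈ B} → ℝ) :=
    Matrix.toLin' (Matrix.of fun z x => ∑ y, rotTensor s z.1 y * a x.1 y)
  -- Were the box larger, some nontrivial combination `w` of its vectors would have a rotated image
  -- vanishing wherever `z ∈ A` and `flip z ∈ B`.
  have hker : LinearMap.ker Φ ≠ ⊥ := LinearMap.ker_ne_bot_of_finrank_lt (by simpa using hlt)
  obtain ⟨l, hl, hl0⟩ := Submodule.exists_mem_ne_zero_of_ne_bot hker
  let m : (ι → Bool) → ℝ := fun x => if hx : x ∈ cubeBox A B then l ⟨x, hx⟩ else 0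
  have hm0 : m ≠ 0 := by
    obtain ⟨x, hx⟩ := Function.ne_iff.mp hl0
    refine Function.ne_iff.mpr ⟨x.1, ?_⟩
    simpa [m] using hx
  let w : (ι → Bool) → ℝ := fun z => ∑ x, m x * a x z
  have hw0 : w ≠ 0 := sum_wingVector_ne_zero hN K hm0
  have hTw : ∀ z, ∑ y, rotTensor s z y * w y
      = ∑ x, m x * ∑ y, rotTensor s z y * a x y := by
    intro z
    simp only [w, Finset.mul_sum]
    rw [Finset.sum_comm]
    exact Finset.sum_congr rfl fun x _ => Finset.sum_congr rfl fun y _ => by ring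
  have hpos := rotTensor_form_pos hs0 hs1 hw0
  -- Every term vanishes: `w` is zero off `A`, its rotated image is zero where `flip z ∉ B`, and the
  -- choice of `l` handles the rest.
  refine hpos.ne' (Finset.sum_eq_zero fun z _ => ?_)
  by_cases hzA : z ∈ A
  · by_cases hzB : flip z ∈ B
    · have h1 := congrFun (LinearMap.mem_ker.mp hl) ⟨z, hzA, hzB⟩
      rw [hTw]
      have h2 : ∑ x, m x * ∑ y, rotTensor s z y * a x y
          = ∑ x : cubeBox A B, l x * ∑ y, rotTensor s z y * a x.1 y := by
        refine (Fintype.sum_of_injective (fun x : cubeBox A B => x.1) Subtype.val_injective _ _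
          (fun x hx => ?_) fun x => ?_).symm
        · have : x ∉ cubeBox A B := fun h => hx ⟨⟨x, h⟩, rfl⟩
          simp [m, this]
        · simp [m]
      rw [h2]
      have h3 : ∑ x : cubeBox A B, l x * ∑ y, rotTensor s z y * a x.1 y = 0 := by
        simpa [Φ, Matrix.toLin'_apply, Matrix.mulVec, dotProduct, mul_comm] using h1
      rw [h3, mul_zero]
    · rw [hTw, Finset.sum_eq_zero, mul_zero]
      intro x _
      by_cases hx : x ∈ cubeBox A B
      · have : ∃ i ∉ K x, z i = x i := by
          by_contra! hcon
          refine hzB ((hK x hx).2 _ fun i hi => ?_)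
          have := hcon i hi
          revert this
          simp only [flip]
          cases z i <;> cases x i <;> simp
        obtain ⟨i, hi, hzi⟩ := this
        rw [sum_rotTensor_mul_wingVector (by omega) hi hzi, mul_zero]
      · simp [m, hx]
  · have : w z = 0 := by
      refine Finset.sum_eq_zero fun x _ => ?_
      by_cases hx : x ∈ cubeBox A B
      · have : ∃ i ∈ K x, z i ≠ x i := by
          by_contra! hcon
          exact hzA ((hK x hx).1 _ hcon)
        obtain ⟨i, hi, hzi⟩ := this
        simp [a, wingVector_eq_zero _ hi hzi]
      · simp [m, hx]
    rw [this, zero_mul]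

end Reimer

/-! ### Single sites and opposite pairs as independent clusters -/

/-- The value `±1` of a Boolean spin. -/
def sgn (b : Bool) : ℝ := if b then 1 else -1

lemma sgn_not (b : Bool) : sgn (!b) = -sgn b := by cases b <;> simp [sgn]

lemma sgn_mul_sgn (a b : Bool) : sgn a * sgn b = 1 - if a ≠ b then 2 else 0 := by
  cases a <;> cases b <;> norm_num [sgn]

section Clusters

variable {V : Type*}

/-- In the disjoint occurrence of increasing events the witnesses may be taken among the plus
spins. -/
lemma exists_plus_witness {A : Set (V → Bool)} (hA : IsUpperSet A) {ω : V → Bool} {K : Finset V}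
    (hK : ∀ α : V → Bool, (∀ i ∈ K, α i = ω i) → α ∈ A) (α : V → Bool)
    (hα : ∀ i ∈ K.filter (fun i => ω i = true), α i = ω i) : α ∈ A := by
  classical
  -- Resetting `α` to `ω` on `K` can only lower it, at the minus spins of `ω`.
  refine hA (a := fun i => if i ∈ K then ω i else α i) (fun i => ?_) (hK _ fun i hi => by simp [hi])
  dsimp only
  split_ifs with hi
  · cases hω : ω i
    · exact bot_le
    · rw [hα i (by simp [hi, hω]), hω]
  · exact le_rfl

open Classical in
/-- The disjoint occurrence inequality for spins grouped into single sites and anti-aligned pairs,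
each group being flipped independently. -/
theorem card_cluster_cubeBox_le {ι : Type*} [Fintype ι] {c : V → ι} {s : V → Bool}
    (hcs : ∀ v w, v ≠ w → c v = c w → s v ≠ s w) {A B : Set (V → Bool)} (hA : IsUpperSet A)
    (hB : IsUpperSet B) :
    Fintype.card {σ : ι → Bool | (fun v => xor (σ (c v)) (s v)) ∈ cubeBox A B} ≤
      Fintype.card {σ : ι → Bool | (fun v => xor (σ (c v)) (s v)) ∈ A ∧
        flip (fun v => xor (σ (c v)) (s v)) ∈ B} := by
  set ψ : (ι → Bool) → V → Bool := fun σ v => xor (σ (c v)) (s v) with hψ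
  have hflip : ∀ σ, flip (ψ σ) = ψ (flip σ) := by
    intro σ
    ext v
    simp [hψ, flip]
  have hsub : {σ | ψ σ ∈ cubeBox A B} ⊆ cubeBox (ψ ⁻¹' A) (ψ ⁻¹' B) := by
    rintro σ ⟨K, L, hKL, hK, hL⟩
    refine ⟨(K.filter fun i => ψ σ i = true).image c, (L.filter fun i => ψ σ i = true).image c,
      ?_, fun τ hτ => ?_, fun τ hτ => ?_⟩
    · rw [Finset.disjoint_left]
      intro j hj hj'
      obtain ⟨v, hv, rfl⟩ := Finset.mem_image.mp hj
      obtain ⟨w, hw, hwv⟩ := Finset.mem_image.mp hj'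
      rw [Finset.mem_filter] at hv hw
      have hne : v ≠ w := by
        rintro rfl
        exact Finset.disjoint_left.mp hKL hv.1 hw.1
      -- Two plus spins in one cluster would have equal `s`.
      refine hcs v w hne hwv.symm ?_
      have h1 := hv.2
      have h2 := hw.2
      simp only [hψ, hwv] at h1 h2
      revert h1 h2
      cases σ (c v) <;> cases s v <;> cases s w <;> simp
    · refine exists_plus_witness hA hK _ fun i hi => ?_
      simp only [hψ]
      rw [hτ (c i) (Finset.mem_image_of_mem c hi)]
    · refine exists_plus_witness hB hL _ fun i hi => ?_
      simp only [hψ]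
      rw [hτ (c i) (Finset.mem_image_of_mem c hi)]
  refine (Set.card_le_card hsub).trans ((card_cubeBox_le _ _).trans (le_of_eq ?_))
  refine Fintype.card_congr (Equiv.setCongr ?_)
  ext σ
  change ψ σ ∈ A ∧ ψ (flip σ) ∈ B ↔ ψ σ ∈ A ∧ flip (ψ σ) ∈ B
  rw [hflip]

open Classical in
/-- The indicator of `A ∩ flip B` minus the indicator of the disjoint occurrence. -/
noncomputable def defect (A B : Set (V → Bool)) (β : V → Bool) : ℝ :=
  (if β ∈ A ∧ flip β ∈ B then 1 else 0) - if β ∈ cubeBox A B then 1 else 0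

end Clusters

/-! ### Partial matchings and powers of the interaction -/

/-- A partial matching of the vertices. The two vertices of an edge share a representative and lie
on different sides; `free` consists of unmatched vertices. The spins of a compatible configuration
cancel outside `free`. -/
structure Pairing (V : Type*) [Fintype V] where
  rep : V → V
  side : V → Bool
  free : Finset V
  rep_rep : ∀ v, rep (rep v) = rep v
  side_rep : ∀ v, side (rep v) = false
  side_ne : ∀ v w, v ≠ w → rep v = rep w → side v ≠ side w
  rep_free : ∀ u ∈ free, rep u = u
  eq_of_rep_eq : ∀ u ∈ free, ∀ v, rep v = u → v = u
  sum_sgn : ∀ β : V → Bool, (∀ v, β v = xor (β (rep v)) (side v)) →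
    ∑ v, sgn (β v) = ∑ v ∈ free, sgn (β v)

namespace Pairing

variable {V : Type*} [Fintype V]

/-- A configuration is compatible if the vertices of each edge carry opposite spins. -/
def Compat (P : Pairing V) (β : V → Bool) : Prop :=
  ∀ v, β v = xor (β (P.rep v)) (P.side v)

/-- The empty matching. -/
def empty (V : Type*) [Fintype V] : Pairing V where
  rep := id
  side _ := false
  free := univ
  rep_rep _ := rfl
  side_rep _ := rfl
  side_ne _ _ h h' := absurd h' h
  rep_free _ _ := rfl
  eq_of_rep_eq _ _ _ h := h
  sum_sgn _ _ := rfl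

lemma compat_empty (β : V → Bool) : (empty V).Compat β := fun v => by simp [empty]

/-- Matched spins cancel in the total, so only disagreements between free vertices vary with `β`. -/
lemma card_sq_sub_sq_sum (P : Pairing V) {β : V → Bool} (hβ : P.Compat β) :
    (Fintype.card V : ℝ) ^ 2 - (∑ v, sgn (β v)) ^ 2 =
      ((Fintype.card V : ℝ) ^ 2 - (#P.free : ℝ) ^ 2) +
        ∑ p ∈ P.free, ∑ q ∈ P.free, if β p ≠ β q then 2 else 0 := by
  rw [P.sum_sgn β hβ, sq (∑ v ∈ P.free, _), Finset.sum_mul_sum]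
  simp only [sgn_mul_sgn, Finset.sum_sub_distrib, Finset.sum_const, nsmul_eq_mul]
  ring

variable [DecidableEq V]

/-- Stated with raw updates because it is needed to build the `sum_sgn` field of `extend`. -/
lemma compat_extend_iff (P : Pairing V) {p q : V} (hq : q ∈ P.free) (hpq : p ≠ q)
    (β : V → Bool) :
    (∀ v, β v = xor (β (Function.update P.rep q p v)) (Function.update P.side q true v)) ↔
      P.Compat β ∧ β p ≠ β q := by
  have hsq : P.side q = false := by rw [← P.rep_free q hq]; exact P.side_rep q
  constructor
  · intro h
    refine ⟨fun v => ?_, ?_⟩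
    · by_cases hv : v = q
      · subst hv
        rw [P.rep_free v hq, hsq, Bool.xor_false]
      · simpa [Function.update_of_ne hv] using h v
    · have := h q
      simp only [Function.update_self, Bool.xor_true] at this
      rw [this]
      cases β p <;> simp
  · rintro ⟨h, hne⟩ v
    by_cases hv : v = q
    · subst hv
      simp only [Function.update_self, Bool.xor_true]
      revert hne
      cases β p <;> cases β v <;> simp
    · simpa [Function.update_of_ne hv] using h v

/-- The matching with the edge `pq` added. -/
def extend (P : Pairing V) (p q : V) (hp : p ∈ P.free) (hq : q ∈ P.free) (hpq : p ≠ q) :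
    Pairing V where
  rep := Function.update P.rep q p
  side := Function.update P.side q true
  free := (P.free.erase p).erase q
  rep_rep v := by
    by_cases hv : v = q
    · subst hv
      rw [Function.update_self, Function.update_of_ne hpq, P.rep_free p hp]
    · rw [Function.update_of_ne hv, Function.update_of_ne (fun h => hv (P.eq_of_rep_eq q hq v h)),
        P.rep_rep]
  side_rep v := by
    by_cases hv : v = q
    · subst hv
      rw [Function.update_self, Function.update_of_ne hpq, ← P.rep_free p hp, P.side_rep]
    · rw [Function.update_of_ne hv, Function.update_of_ne (fun h => hv (P.eq_of_rep_eq q hq v h)),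
        P.side_rep]
  side_ne v w hvw h := by
    have hsp : P.side p = false := by rw [← P.rep_free p hp]; exact P.side_rep p
    by_cases hv : v = q
    · subst hv
      rw [Function.update_self, Function.update_of_ne hvw.symm] at h
      rw [P.eq_of_rep_eq p hp w h.symm, Function.update_self, Function.update_of_ne hpq, hsp]
      simp
    · by_cases hw : w = q
      · subst hw
        rw [Function.update_self, Function.update_of_ne hvw] at h
        rw [P.eq_of_rep_eq p hp v h, Function.update_self, Function.update_of_ne hpq, hsp]
        simp
      · rw [Function.update_of_ne hv, Function.update_of_ne hw] at h ⊢
        exact P.side_ne v w hvw h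
  rep_free u hu := by
    simp only [Finset.mem_erase] at hu
    rw [Function.update_of_ne hu.1, P.rep_free u hu.2.2]
  eq_of_rep_eq u hu v h := by
    simp only [Finset.mem_erase] at hu
    by_cases hv : v = q
    · subst hv
      rw [Function.update_self] at h
      exact absurd h.symm hu.2.1
    · rw [Function.update_of_ne hv] at h
      exact P.eq_of_rep_eq u hu.2.2 v h
  sum_sgn β hβ := by
    rw [P.compat_extend_iff hq hpq] at hβ
    rw [P.sum_sgn β hβ.1, ← Finset.add_sum_erase _ _ hp,
      ← Finset.add_sum_erase _ _ (Finset.mem_erase.mpr ⟨hpq.symm, hq⟩)]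
    have : β q = !β p := by
      have := hβ.2
      revert this
      cases β p <;> cases β q <;> simp
    rw [this, sgn_not]
    ring

lemma compat_extend (P : Pairing V) {p q : V} (hp : p ∈ P.free) (hq : q ∈ P.free)
    (hpq : p ≠ q) (β : V → Bool) :
    (P.extend p q hp hq hpq).Compat β ↔ P.Compat β ∧ β p ≠ β q :=
  P.compat_extend_iff hq hpq β

open Classical in
-- Compatible configurations are parametrized by arbitrary spins on the representatives, so the
-- cluster inequality applies.
lemma sum_defect_nonneg (P : Pairing V) {A B : Set (V → Bool)} (hA : IsUpperSet A)
    (hB : IsUpperSet B) : 0 ≤ ∑ β, if P.Compat β then defect A B β else 0 := by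
  let c : V → {v // P.rep v = v} := fun v => ⟨P.rep v, P.rep_rep v⟩
  let ψ : ({v // P.rep v = v} → Bool) → V → Bool := fun σ v => xor (σ (c v)) (P.side v)
  have hc : ∀ v : {v // P.rep v = v}, c v = v := fun v => Subtype.ext v.2
  have hs : ∀ v : {v // P.rep v = v}, P.side v = false := fun v => by
    rw [← v.2, P.side_rep]
  have hψr : ∀ σ (v : {v // P.rep v = v}), ψ σ v = σ v := fun σ v => by simp [ψ, hc, hs]
  have hinj : Function.Injective ψ := fun σ τ h => by
    ext v
    rw [← hψr σ, h, hψr]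
  have hsum : ∑ β, (if P.Compat β then defect A B β else 0) = ∑ σ, defect A B (ψ σ) := by
    refine (Fintype.sum_of_injective ψ hinj _ _ (fun β hβ => ?_) fun σ => ?_).symm
    · rw [if_neg]
      refine fun h => hβ ⟨fun v => β v, ?_⟩
      ext v
      rw [h v]
    · rw [if_pos]
      intro v
      have := hψr σ (c v)
      change ψ σ v = xor (ψ σ (c v)) _
      rw [this]
  rw [hsum]
  have hcard := card_cluster_cubeBox_le (c := c) (s := P.side)
    (fun v w hvw h => P.side_ne v w hvw (congrArg Subtype.val h)) hA hB
  simp only [defect, Finset.sum_sub_distrib, Finset.sum_boole, sub_nonneg, Nat.cast_le]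
  rw [Fintype.card_subtype, Fintype.card_subtype] at hcard
  simpa using hcard

open Classical in
-- Induction over all matchings at once: one factor is a nonnegative constant plus disagreement
-- indicators, and each indicator adds an edge.
theorem sum_pow_mul_defect_nonneg {A B : Set (V → Bool)} (hA : IsUpperSet A) (hB : IsUpperSet B)
    (k : ℕ) (P : Pairing V) :
    0 ≤ ∑ β, if P.Compat β then
      ((Fintype.card V : ℝ) ^ 2 - (∑ v, sgn (β v)) ^ 2) ^ k * defect A B β else 0 := by
  induction k generalizing P with
  | zero => simpa using P.sum_defect_nonneg hA hB
  | succ k ih =>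
    set g : (V → Bool) → ℝ := fun β =>
      ((Fintype.card V : ℝ) ^ 2 - (∑ v, sgn (β v)) ^ 2) ^ k * defect A B β with hg
    have key : ∀ β : V → Bool, (if P.Compat β then
        ((Fintype.card V : ℝ) ^ 2 - (∑ v, sgn (β v)) ^ 2) ^ (k + 1) * defect A B β else 0) =
        ((Fintype.card V : ℝ) ^ 2 - (#P.free : ℝ) ^ 2) * (if P.Compat β then g β else 0) +
        ∑ p ∈ P.free, ∑ q ∈ P.free, 2 * (if P.Compat β ∧ β p ≠ β q then g β else 0) := by
      intro β
      by_cases hβ : P.Compat β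
      · simp only [hβ, if_true, true_and]
        rw [pow_succ', mul_assoc]
        change _ * g β = _
        rw [P.card_sq_sub_sq_sum hβ, add_mul, Finset.sum_mul]
        congr 1
        refine Finset.sum_congr rfl fun p _ => ?_
        rw [Finset.sum_mul]
        refine Finset.sum_congr rfl fun q _ => ?_
        split_ifs <;> simp
      · simp [hβ]
    simp only [key, Finset.sum_add_distrib]
    rw [← Finset.mul_sum]
    refine add_nonneg (mul_nonneg ?_ (ih P)) ?_
    · have : (#P.free : ℝ) ≤ Fintype.card V := by exact_mod_cast Finset.card_le_univ _
      nlinarith [(#P.free).cast_nonneg (α := ℝ)]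
    · rw [Finset.sum_comm]
      refine Finset.sum_nonneg fun p hp => ?_
      rw [Finset.sum_comm]
      refine Finset.sum_nonneg fun q hq => ?_
      rw [← Finset.mul_sum]
      refine mul_nonneg zero_le_two ?_
      by_cases hpq : p = q
      · simp [hpq]
      · simpa only [compat_extend] using ih (P.extend p q hp hq hpq)

end Pairing

/-- The folded disjoint occurrence inequality for the antiferromagnetic weight without external
field. -/
theorem sum_exp_mul_defect_nonneg {V : Type*} [Fintype V] [DecidableEq V]
    {A B : Set (V → Bool)} (hA : IsUpperSet A) (hB : IsUpperSet B) {t : ℝ} (ht : 0 ≤ t) :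
    0 ≤ ∑ β, Real.exp (t * ((Fintype.card V : ℝ) ^ 2 - (∑ v, sgn (β v)) ^ 2)) *
      defect A B β := by
  have hsum : HasSum (fun k : ℕ => ∑ β : V → Bool,
      (t * ((Fintype.card V : ℝ) ^ 2 - (∑ v, sgn (β v)) ^ 2)) ^ k / k.factorial * defect A B β)
      (∑ β, Real.exp (t * ((Fintype.card V : ℝ) ^ 2 - (∑ v, sgn (β v)) ^ 2)) *
        defect A B β) := by
    refine hasSum_sum fun β _ => HasSum.mul_right _ ?_
    rw [Real.exp_eq_exp_ℝ]
    exact NormedSpace.expSeries_div_hasSum_exp _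
  refine hsum.nonneg fun k => ?_
  have h := Pairing.sum_pow_mul_defect_nonneg hA hB k (Pairing.empty V)
  simp only [Pairing.compat_empty, if_true] at h
  have : ∑ β : V → Bool, (t * ((Fintype.card V : ℝ) ^ 2 - (∑ v, sgn (β v)) ^ 2)) ^ k /
      k.factorial * defect A B β = t ^ k / k.factorial *
        ∑ β : V → Bool, ((Fintype.card V : ℝ) ^ 2 - (∑ v, sgn (β v)) ^ 2) ^ k * defect A B β := by
    rw [Finset.mul_sum]
    refine Finset.sum_congr rfl fun β _ => ?_
    rw [mul_pow]
    ring
  rw [this]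
  exact mul_nonneg (by positivity) h

/-! ### Folding pairs of configurations along their disagreement set -/

lemma sum_Ioi_mul {n : ℕ} (x : Fin n → ℝ) :
    2 * ∑ i, ∑ j ∈ Finset.Ioi i, x i * x j = (∑ i, x i) ^ 2 - ∑ i, x i ^ 2 := by
  have h1 : ∀ i : Fin n, ∑ j, x i * x j =
      ∑ j, (if i < j then x i * x j else 0) + ∑ j, (if j < i then x j * x i else 0) + x i ^ 2 := by
    intro i
    rw [← Finset.sum_add_distrib]
    have : x i ^ 2 = ∑ j, if i = j then x i * x j else 0 := by simp [sq]
    rw [this, ← Finset.sum_add_distrib]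
    refine Finset.sum_congr rfl fun j _ => ?_
    rcases lt_trichotomy i j with h | h | h
    · simp [h, h.not_gt, h.ne]
    · simp [h]
    · simp [h, h.not_gt, h.ne', mul_comm]
  have h2 : ∀ i : Fin n, ∑ j ∈ Finset.Ioi i, x i * x j =
      ∑ j, if i < j then x i * x j else 0 := by
    intro i
    rw [← Finset.sum_filter]
    congr 1
    ext j
    simp
  rw [sq, Finset.sum_mul_sum]
  simp only [h1, h2, Finset.sum_add_distrib]
  rw [Finset.sum_comm (f := fun i j => if j < i then x j * x i else 0)]
  ring

/-- The Curie-Weiss weight of a Boolean configuration, up to a constant factor. -/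
noncomputable def cubeWeight {V : Type*} [Fintype V] (J : ℝ) (h : V → ℝ) (ω : V → Bool) : ℝ :=
  Real.exp (J * (∑ v, sgn (ω v)) ^ 2 / 2 + ∑ v, h v * sgn (ω v))

section Folding

variable {V : Type*}

/-- The configuration equal to `β` on `D` and to `α` off `D`. -/
def glue (D : V → Bool) (β : {v // D v = true} → Bool) (α : {v // ¬ D v = true} → Bool) :
    V → Bool :=
  (Equiv.piEquivPiSubtypeProd (fun v => D v = true) (fun _ => Bool)).symm (β, α)

variable (D : V → Bool) (β : {v // D v = true} → Bool) (α : {v // ¬ D v = true} → Bool)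

lemma glue_of_true {v : V} (hv : D v = true) : glue D β α v = β ⟨v, hv⟩ := by
  simp [glue, Equiv.piEquivPiSubtypeProd, hv]

lemma glue_of_not_true {v : V} (hv : ¬ D v = true) : glue D β α v = α ⟨v, hv⟩ := by
  simp [glue, Equiv.piEquivPiSubtypeProd, hv]

lemma xor_glue : (fun v => xor (glue D β α v) (D v)) = glue D (flip β) α := by
  ext v
  by_cases hv : D v = true
  · simp only [glue_of_true D _ _ hv, flip, hv, Bool.xor_true]
  · simp only [glue_of_not_true D _ _ hv]
    simp [hv]

lemma glue_mono {β β' : {v // D v = true} → Bool} (h : β ≤ β') : glue D β α ≤ glue D β' α := by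
  intro v
  by_cases hv : D v = true
  · rw [glue_of_true D _ _ hv, glue_of_true D _ _ hv]
    exact h _
  · rw [glue_of_not_true D _ _ hv, glue_of_not_true D _ _ hv]

/-- Sites off `D` can be dropped from the witnesses, since `α` is fixed there. -/
lemma mem_cubeBox_slice {A B : Set (V → Bool)} (h : glue D β α ∈ cubeBox A B) :
    β ∈ cubeBox {β | glue D β α ∈ A} {β | glue D β α ∈ B} := by
  obtain ⟨K, L, hKL, hK, hL⟩ := h
  have aux : ∀ {M : Finset V} {β' : {v // D v = true} → Bool},
      (∀ i ∈ M.subtype (fun v => D v = true), β' i = β i) →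
      ∀ i ∈ M, glue D β' α i = glue D β α i := by
    intro M β' hβ' i hi
    by_cases hv : D i = true
    · rw [glue_of_true D _ _ hv, glue_of_true D _ _ hv]
      exact hβ' _ (by simpa using hi)
    · rw [glue_of_not_true D _ _ hv, glue_of_not_true D _ _ hv]
  refine ⟨K.subtype _, L.subtype _, ?_, fun β' hβ' => hK _ (aux hβ'), fun β' hβ' => hL _ (aux hβ')⟩
  rw [Finset.disjoint_left]
  intro i hi hi'
  exact Finset.disjoint_left.mp hKL (Finset.mem_subtype.mp hi) (Finset.mem_subtype.mp hi')

variable [Fintype V]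

lemma sum_glue (f : V → Bool → ℝ) : ∑ v, f v (glue D β α v) =
    ∑ v : {v // D v = true}, f v (β v) + ∑ v : {v // ¬ D v = true}, f v (α v) := by
  rw [← Fintype.sum_subtype_add_sum_subtype (fun v => D v = true)]
  congr 1
  · exact Finset.sum_congr rfl fun v _ => by rw [glue_of_true D β α v.2]
  · exact Finset.sum_congr rfl fun v _ => by rw [glue_of_not_true D β α v.2]

/-- In the product of the weights of two configurations that disagree exactly on `D`, the fields
on `D` and the interaction between `D` and its complement cancel. -/
lemma cubeWeight_glue_mul (J : ℝ) (h : V → ℝ) :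
    cubeWeight J h (glue D β α) * cubeWeight J h (glue D (flip β) α) =
      Real.exp (J * (∑ v, sgn (α v)) ^ 2 + J * (Fintype.card {v // D v = true} : ℝ) ^ 2 +
        2 * ∑ v : {v // ¬ D v = true}, h v * sgn (α v)) *
      Real.exp (-J * ((Fintype.card {v // D v = true} : ℝ) ^ 2 - (∑ v, sgn (β v)) ^ 2)) := by
  rw [cubeWeight, cubeWeight, ← Real.exp_add, ← Real.exp_add,
    sum_glue D β α (fun _ b => sgn b), sum_glue D (flip β) α (fun _ b => sgn b),
    sum_glue D β α (fun v b => h v * sgn b), sum_glue D (flip β) α (fun v b => h v * sgn b)]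
  simp only [flip, sgn_not, mul_neg, Finset.sum_neg_distrib]
  congr 1
  ring

variable [DecidableEq V]

/-- Replace `ω'` by `D = ω xor ω'`, then split `ω` along `D`. -/
lemma sum_sum_xor (f : (V → Bool) → (V → Bool) → ℝ) :
    ∑ ω, ∑ ω', f ω ω' = ∑ D : V → Bool, ∑ α, ∑ β, f (glue D β α) (glue D (flip β) α) := by
  have h1 : ∀ ω, ∑ ω', f ω ω' = ∑ D : V → Bool, f ω (fun v => xor (ω v) (D v)) := by
    intro ω
    have hinv : Function.Involutive (fun (D : V → Bool) v => xor (ω v) (D v)) := fun D => by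
      ext v
      simp
    exact (Equiv.sum_comp hinv.toPerm (f ω)).symm
  simp only [h1]
  rw [Finset.sum_comm]
  refine Finset.sum_congr rfl fun D _ => ?_
  rw [← Equiv.sum_comp (Equiv.piEquivPiSubtypeProd (fun v => D v = true) (fun _ => Bool)).symm,
    Fintype.sum_prod_type_right]
  refine Finset.sum_congr rfl fun α _ => Finset.sum_congr rfl fun β _ => ?_
  rw [← xor_glue]
  rfl

open Classical in
/-- The BK inequality for the Curie-Weiss weight on a Boolean cube. -/
theorem cubeWeight_cubeBox_le {J : ℝ} (hJ : J ≤ 0) (h : V → ℝ) {A B : Set (V → Bool)}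
    (hA : IsUpperSet A) (hB : IsUpperSet B) :
    (∑ ω, (cubeBox A B).indicator (cubeWeight J h) ω) * ∑ ω, cubeWeight J h ω ≤
      (∑ ω, A.indicator (cubeWeight J h) ω) * ∑ ω, B.indicator (cubeWeight J h) ω := by
  rw [← sub_nonneg, Finset.sum_mul_sum, Finset.sum_mul_sum, ← Finset.sum_sub_distrib]
  simp only [← Finset.sum_sub_distrib]
  rw [sum_sum_xor]
  refine Finset.sum_nonneg fun D _ => Finset.sum_nonneg fun α _ => ?_
  set A' : Set ({v // D v = true} → Bool) := {β | glue D β α ∈ A} with hA'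
  set B' : Set ({v // D v = true} → Bool) := {β | glue D β α ∈ B} with hB'
  have key := sum_exp_mul_defect_nonneg (A := A') (B := B')
    (fun _ _ hle hβ => hA (glue_mono D α hle) hβ) (fun _ _ hle hβ => hB (glue_mono D α hle) hβ)
    (neg_nonneg.mpr hJ)
  have hterm : ∀ β, Real.exp (J * (∑ v, sgn (α v)) ^ 2 +
        J * (Fintype.card {v // D v = true} : ℝ) ^ 2 + 2 * ∑ v : {v // ¬ D v = true}, h v * sgn (α v)) *
      (Real.exp (-J * ((Fintype.card {v // D v = true} : ℝ) ^ 2 - (∑ v, sgn (β v)) ^ 2)) *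
        defect A' B' β) ≤
      A.indicator (cubeWeight J h) (glue D β α) * B.indicator (cubeWeight J h) (glue D (flip β) α)
      - (cubeBox A B).indicator (cubeWeight J h) (glue D β α) *
        cubeWeight J h (glue D (flip β) α) := by
    intro β
    rw [← mul_assoc, ← cubeWeight_glue_mul]
    have hw : 0 ≤ cubeWeight J h (glue D β α) * cubeWeight J h (glue D (flip β) α) :=
      mul_nonneg (Real.exp_nonneg _) (Real.exp_nonneg _)
    rw [defect, mul_sub]
    -- The first terms agree exactly; the box only embeds in the box of the slices, which is the
    -- favourable direction.
    refine sub_le_sub (le_of_eq ?_) ?_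
    · simp only [Set.indicator, hA', hB', Set.mem_ofPred_eq]
      by_cases h1 : glue D β α ∈ A <;> by_cases h2 : glue D (flip β) α ∈ B <;> simp [h1, h2]
    · by_cases h1 : glue D β α ∈ cubeBox A B
      · simp [h1, hA', hB', mem_cubeBox_slice D β α h1]
      · rw [Set.indicator_of_notMem h1, zero_mul]
        split_ifs <;> simp [hw]
  refine le_trans ?_ (Finset.sum_le_sum fun β _ => hterm β)
  rw [← Finset.mul_sum]
  exact mul_nonneg (Real.exp_nonneg _) key

end Folding

/-! ### Transfer from the Boolean cube to spins -/

/-- The order isomorphism between Boolean values and spins. -/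
def boolEquivSpin : Bool ≃o Spin where
  toFun b := if b then ⟨1, by simp⟩ else ⟨-1, by simp⟩
  invFun s := decide ((s : ℤ) = 1)
  left_inv b := by cases b <;> simp
  right_inv := by decide
  map_rel_iff' := by decide

lemma spinVal_boolEquivSpin (b : Bool) : spinVal (boolEquivSpin b) = sgn b := by
  cases b <;> simp [boolEquivSpin, spinVal, sgn]

/-- The bijection between Boolean and spin configurations. -/
def cubeEquiv (n : ℕ) : (Fin n → Bool) ≃ (Fin n → Spin) :=
  Equiv.arrowCongr (Equiv.refl _) boolEquivSpin.toEquiv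

lemma cubeEquiv_apply {n : ℕ} (ω : Fin n → Bool) (i : Fin n) :
    cubeEquiv n ω i = boolEquivSpin (ω i) := rfl

/-- The constant comes from the diagonal terms of the squared spin sum, each equal to 1. -/
lemma weight_cubeEquiv {n : ℕ} (J : ℝ) (h : Fin n → ℝ) (ω : Fin n → Bool) :
    weight J h (cubeEquiv n ω) = Real.exp (-(J * n / 2)) * cubeWeight J h ω := by
  rw [weight, cubeWeight, ← Real.exp_add]
  simp only [cubeEquiv_apply, spinVal_boolEquivSpin, mul_assoc, ← Finset.mul_sum]
  have h1 := sum_Ioi_mul fun i => sgn (ω i)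
  have h2 : ∑ i, sgn (ω i) ^ 2 = n := by
    have : ∀ b, sgn b ^ 2 = 1 := fun b => by cases b <;> simp [sgn]
    simp [this]
  simp only [h2, ← Finset.mul_sum] at h1
  congr 1
  linear_combination J / 2 * h1

lemma preimage_box {n : ℕ} (A B : Set (Fin n → Spin)) :
    cubeEquiv n ⁻¹' box A B ⊆ cubeBox (cubeEquiv n ⁻¹' A) (cubeEquiv n ⁻¹' B) := by
  rintro ω ⟨K, L, hKL, hK, hL⟩
  refine ⟨K, L, hKL, fun α hα => hK fun i hi => ?_, fun α hα => hL fun i hi => ?_⟩ <;>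
  rw [cubeEquiv_apply, cubeEquiv_apply, hα i hi]

lemma isUpperSet_preimage {n : ℕ} {A : Set (Fin n → Spin)} (hA : IsUpperSet A) :
    IsUpperSet (cubeEquiv n ⁻¹' A) := fun _ _ hle hω =>
  hA (fun i => boolEquivSpin.monotone (hle i)) hω

lemma prob_eq {n : ℕ} (J : ℝ) (h : Fin n → ℝ) (A : Set (Fin n → Spin)) :
    prob J h A = (∑ ω, (cubeEquiv n ⁻¹' A).indicator (cubeWeight J h) ω) /
      ∑ ω, cubeWeight J h ω := by
  have hZ : partitionFunction J h = Real.exp (-(J * n / 2)) * ∑ ω, cubeWeight J h ω := by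
    rw [partitionFunction, ← Equiv.sum_comp (cubeEquiv n), Finset.mul_sum]
    exact Finset.sum_congr rfl fun ω _ => weight_cubeEquiv J h ω
  rw [prob, ← Equiv.sum_comp (cubeEquiv n), Finset.sum_div]
  refine Finset.sum_congr rfl fun ω _ => ?_
  by_cases hω : cubeEquiv n ω ∈ A
  · rw [Set.indicator_of_mem hω, Set.indicator_of_mem (s := cubeEquiv n ⁻¹' A) hω, mass,
      weight_cubeEquiv, hZ, mul_div_mul_left _ _ (Real.exp_ne_zero _)]
  · rw [Set.indicator_of_notMem hω, Set.indicator_of_notMem (s := cubeEquiv n ⁻¹' A) hω, zero_div]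

end CurieWeiss

theorem theorem1p3 (n : ℕ) (J : ℝ) (hJ : J ≤ 0) (h : Fin n → ℝ)
    (A B : Set (Fin n → CurieWeiss.Spin)) (hA : IsUpperSet A) (hB : IsUpperSet B) :
    CurieWeiss.prob J h (CurieWeiss.box A B)
      ≤ CurieWeiss.prob J h A * CurieWeiss.prob J h B := by
  have hZ : 0 < ∑ ω : Fin n → Bool, CurieWeiss.cubeWeight J h ω :=
    Finset.sum_pos (fun _ _ => Real.exp_pos _) Finset.univ_nonempty
  rw [CurieWeiss.prob_eq, CurieWeiss.prob_eq, CurieWeiss.prob_eq, div_mul_div_comm,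
    div_le_div_iff₀ hZ (mul_pos hZ hZ), ← mul_assoc]
  refine mul_le_mul_of_nonneg_right (le_trans (mul_le_mul_of_nonneg_right ?_ hZ.le)
    (CurieWeiss.cubeWeight_cubeBox_le hJ h (CurieWeiss.isUpperSet_preimage hA)
      (CurieWeiss.isUpperSet_preimage hB))) hZ.le
  exact Finset.sum_le_sum fun ω _ => Set.indicator_le_indicator_of_subset
    (CurieWeiss.preimage_box A B) (fun _ => Real.exp_nonneg _) ω
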